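/- Let $A\in\mathbb R^{m\times d}$ have full row rank and $c\in\mathbb R^d$. For $b\in\mathbb R^m$ consider the standard-form linear program $\min\{c^\top x : Ax=b,\ x\ge 0\}$. Let right-hand sides $b^1,\dots,b^n\in\mathbb R^m$ be given such that for every $b$ in the convex hull of $\{b^1,\dots,b^n\}$ the program has a unique optimal solution, denoted by $x^\star(b)$. Let $\mathbf B^1,\dots,\mathbf B^L$ be bases (invertible $m\times m$ matrices formed by columns of $A$), and let each $j\in\{1,\dots,n\}$ be assigned a label $\ell(j)\in\{1,\dots,L\}$, every label being used, such that $\mathbf B^{\ell(j)}$ is an optimal basis at $b^j$, that is, $(\mathbf B^{\ell(j)})^{-1}b^j\ge 0$ and all reduced costs of $\mathbf B^{\ell(j)}$ are nonnegative. Define the cells $\mathcal C^\ell=\{b^j : \ell(j)=\ell\}$. Then the system of linear inequalities $$\langle u^{\ell(j)}_k, b^i-b^j\rangle + x^\star(b^j)_k + z^j_k\ \le\ x^\star(b^i)_k+z^i_k,\qquad \langle v^{\ell(j)}_k, b^i-b^j\rangle + z^j_k\ \le\ z^i_k\qquad (1\le i,j\le n,\ 1\le k\le d)$$ in the unknowns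 $u^\ell_k,v^\ell_k\in\mathbb R^m$ $(1\le \ell\le L)$ and $z^j_k\in\mathbb R$ $(1\le j\le n)$ has at least one solution. Moreover, let $(u,v,z)$ be any solution and, for each $\ell$, select any index $r(\ell)\in\{1,\dots,n\}$ with $\ell(r(\ell))=\ell$. Then the policy $\phi:\mathbb R^m\to\mathbb R^d$ defined by $$\phi(b)_k=\max_{1\le \ell\le L}\Big(\langle u^\ell_k, b-b^{r(\ell)}\rangle+x^\star(b^{r(\ell)})_k+z^{r(\ell)}_k\Big)-\max_{1\le \ell\le L}\Big(\langle v^\ell_k, b-b^{r(\ell)}\rangle+z^{r(\ell)}_k\Big)$$ satisfies $\phi(b)=x^\star(b)$ for every $\ell\in\{1,\dots,L\}$ and every $b$ in the convex hull of $\mathcal C^\ell$. -/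

import Mathlib

open Matrix

/-- `x` is feasible for the standard-form linear program `min {cᵀx : A x = b, x ≥ 0}`. -/
def LPFeasible {m d : ℕ} (A : Matrix (Fin m) (Fin d) ℝ) (b : Fin m → ℝ) (x : Fin d → ℝ) : Prop :=
  A *ᵥ x = b ∧ ∀ k, 0 ≤ x k

/-- `x` is an optimal solution of `min {cᵀx : A x = b, x ≥ 0}`. -/
def LPOptimal {m d : ℕ} (A : Matrix (Fin m) (Fin d) ℝ) (c : Fin d → ℝ) (b : Fin m → ℝ)
    (x : Fin d → ℝ) : Prop :=
  LPFeasible A b x ∧ ∀ y, LPFeasible A b y → c ⬝ᵥ x ≤ c ⬝ᵥ y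

/-- `x` is the unique optimal solution of `min {cᵀx : A x = b, x ≥ 0}`. -/
def LPUniqueOptimal {m d : ℕ} (A : Matrix (Fin m) (Fin d) ℝ) (c : Fin d → ℝ) (b : Fin m → ℝ)
    (x : Fin d → ℝ) : Prop :=
  LPOptimal A c b x ∧ ∀ y, LPOptimal A c b y → y = x

/-- The square matrix of the columns of `A` selected by `σ`. An increasing map
`σ : Fin m ↪o Fin d` is the same thing as a set of `m` column indices. -/
def basisMatrix {m d : ℕ} (A : Matrix (Fin m) (Fin d) ℝ) (σ : Fin m ↪o Fin d) :
    Matrix (Fin m) (Fin m) ℝ :=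
  A.submatrix id σ

/-- `σ` selects an optimal basis `𝐁` of `min {cᵀx : A x = b, x ≥ 0}`: the columns form an
invertible matrix, the basic solution `𝐁⁻¹ b` is nonnegative, and all the reduced costs
`c_k - c_Bᵀ 𝐁⁻¹ A_k` are nonnegative. -/
structure IsOptimalBasis {m d : ℕ} (A : Matrix (Fin m) (Fin d) ℝ) (c : Fin d → ℝ)
    (b : Fin m → ℝ) (σ : Fin m ↪o Fin d) : Prop where
  isUnit_det : IsUnit (basisMatrix A σ).det
  basic_nonneg : ∀ i, 0 ≤ ((basisMatrix A σ)⁻¹ *ᵥ b) i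
  reducedCost_nonneg : ∀ k, 0 ≤ c k - (((c ∘ σ) ᵥ* (basisMatrix A σ)⁻¹) ᵥ* A) k

/-- The cell with label `l`: the right-hand sides of the data that are assigned to `l`. -/
def cellSet {m n L : ℕ} (b : Fin n → Fin m → ℝ) (cell : Fin n → Fin L) (l : Fin L) :
    Set (Fin m → ℝ) :=
  {p | ∃ j, cell j = l ∧ b j = p}

/-- The system of linear inequalities for the parameters `u l k, v l k ∈ ℝᵐ` (one pair per cell
`l` and coordinate `k`) and `z j k ∈ ℝ` (one per data point `j` and coordinate `k`). -/
def PolicyInequalities {m d n L : ℕ} (b : Fin n → Fin m → ℝ) (cell : Fin n → Fin L)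
    (xstar : (Fin m → ℝ) → Fin d → ℝ) (u v : Fin L → Fin d → Fin m → ℝ)
    (z : Fin n → Fin d → ℝ) : Prop :=
  (∀ k i j, u (cell j) k ⬝ᵥ (b i - b j) + xstar (b j) k + z j k ≤ xstar (b i) k + z i k) ∧
  (∀ k i j, v (cell j) k ⬝ᵥ (b i - b j) + z j k ≤ z i k)

/-- The max-minus-max policy, where `r l` is the data point selected from the cell `l`. The
suprema are maxima over the finite set of cells. -/
noncomputable def pldcPolicy {m d n L : ℕ} (b : Fin n → Fin m → ℝ)
    (xstar : (Fin m → ℝ) → Fin d → ℝ) (r : Fin L → Fin n) (u v : Fin L → Fin d → Fin m → ℝ)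
    (z : Fin n → Fin d → ℝ) (p : Fin m → ℝ) : Fin d → ℝ :=
  fun k =>
    (⨆ l : Fin L, (u l k ⬝ᵥ (p - b (r l)) + xstar (b (r l)) k + z (r l) k)) -
      ⨆ l : Fin L, (v l k ⬝ᵥ (p - b (r l)) + z (r l) k)

/-! For the dual prices `y l` of a basis, `y l ⬝ᵥ p` minorizes the optimal value and is exact on the
cell. Where it is exact, complementary slackness and uniqueness make `xstar` the restriction of a
linear map `W l` (`exists_linearMap_eq_xstar`). A large multiple `M` of the value function then
absorbs the errors of `W l` at other data points: where the duality gap vanishes, so does the error.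
Conversely, inequalities between points of one cell hold in both directions, so piece `l`
interpolates its cell and dominates there. Both maxima are thus affine on the hull, and their
difference agrees with `W l`. -/

/-- The vector of dual prices `c_Bᵀ 𝐁⁻¹` of the basis selected by `σ`. -/
noncomputable def basisDual {m d : ℕ} (A : Matrix (Fin m) (Fin d) ℝ) (c : Fin d → ℝ)
    (σ : Fin m ↪o Fin d) : Fin m → ℝ :=
  (c ∘ σ) ᵥ* (basisMatrix A σ)⁻¹

theorem LPFeasible.weak_duality {m d : ℕ} {A : Matrix (Fin m) (Fin d) ℝ} {c : Fin d → ℝ}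
    {p y : Fin m → ℝ} {x : Fin d → ℝ} (hx : LPFeasible A p x) (hy : y ᵥ* A ≤ c) :
    y ⬝ᵥ p ≤ c ⬝ᵥ x := by
  rw [← hx.1, Matrix.dotProduct_mulVec]
  exact dotProduct_le_dotProduct_of_nonneg_right hy hx.2

theorem LPFeasible.optimal_of_tight {m d : ℕ} {A : Matrix (Fin m) (Fin d) ℝ} {c : Fin d → ℝ}
    {p y : Fin m → ℝ} {x : Fin d → ℝ} (hx : LPFeasible A p x) (hy : y ᵥ* A ≤ c)
    (h : y ⬝ᵥ p = c ⬝ᵥ x) : LPOptimal A c p x :=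
  ⟨hx, fun _ hw => h ▸ hw.weak_duality hy⟩

theorem LPFeasible.convex_comb {m d : ℕ} {A : Matrix (Fin m) (Fin d) ℝ}
    {p q : Fin m → ℝ} {x w : Fin d → ℝ} (hx : LPFeasible A p x) (hw : LPFeasible A q w)
    {s t : ℝ} (hs : 0 ≤ s) (ht : 0 ≤ t) : LPFeasible A (s • p + t • q) (s • x + t • w) := by
  refine ⟨by rw [Matrix.mulVec_add, Matrix.mulVec_smul, Matrix.mulVec_smul, hx.1, hw.1],
    fun k => ?_⟩
  have h1 := mul_nonneg hs (hx.2 k)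
  have h2 := mul_nonneg ht (hw.2 k)
  simpa using add_nonneg h1 h2

theorem IsOptimalBasis.dual_feasible {m d : ℕ} {A : Matrix (Fin m) (Fin d) ℝ} {c : Fin d → ℝ}
    {p : Fin m → ℝ} {σ : Fin m ↪o Fin d} (h : IsOptimalBasis A c p σ) :
    basisDual A c σ ᵥ* A ≤ c :=
  fun k => sub_nonneg.1 (h.reducedCost_nonneg k)

theorem IsOptimalBasis.exists_tight {m d : ℕ} {A : Matrix (Fin m) (Fin d) ℝ} {c : Fin d → ℝ}
    {p : Fin m → ℝ} {σ : Fin m ↪o Fin d} (h : IsOptimalBasis A c p σ) :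
    ∃ x, LPFeasible A p x ∧ basisDual A c σ ⬝ᵥ p = c ⬝ᵥ x := by
  -- `P` pads a vector of basic variables with zeros.
  set P : Matrix (Fin d) (Fin m) ℝ := (1 : Matrix (Fin d) (Fin d) ℝ).submatrix id σ with hP
  set w := (basisMatrix A σ)⁻¹ *ᵥ p with hw
  have hAP : A * P = basisMatrix A σ := by
    ext i j
    simp [hP, basisMatrix, Matrix.mul_apply, Matrix.one_apply]
  have hcP : c ᵥ* P = c ∘ σ := by
    ext j
    simp [hP, Matrix.vecMul, dotProduct, Matrix.one_apply]
  refine ⟨P *ᵥ w, ⟨?_, fun k => ?_⟩, ?_⟩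
  · rw [Matrix.mulVec_mulVec, hAP, hw, Matrix.mulVec_mulVec, Matrix.mul_nonsing_inv _ h.isUnit_det,
      Matrix.one_mulVec]
  · change 0 ≤ ∑ i, P k i * w i
    refine Finset.sum_nonneg fun i _ => mul_nonneg ?_ (h.basic_nonneg i)
    rw [hP, Matrix.submatrix_apply, Matrix.one_apply]
    split_ifs <;> norm_num
  · rw [Matrix.dotProduct_mulVec, hcP, basisDual, hw, Matrix.dotProduct_mulVec]

theorem LPUniqueOptimal.tight_of_isOptimalBasis {m d : ℕ} {A : Matrix (Fin m) (Fin d) ℝ}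
    {c : Fin d → ℝ} {p : Fin m → ℝ} {x : Fin d → ℝ} {σ : Fin m ↪o Fin d}
    (hx : LPUniqueOptimal A c p x) (h : IsOptimalBasis A c p σ) :
    basisDual A c σ ⬝ᵥ p = c ⬝ᵥ x := by
  obtain ⟨w, hw, ht⟩ := h.exists_tight
  rw [← hx.2 w (hw.optimal_of_tight h.dual_feasible ht), ht]

/-- The right-hand sides of `H` at which the dual solution `y` is optimal. -/
def tightSet {m d : ℕ} (c : Fin d → ℝ) (H : Set (Fin m → ℝ)) (xstar : (Fin m → ℝ) → Fin d → ℝ)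
    (y : Fin m → ℝ) : Set (Fin m → ℝ) :=
  {p | p ∈ H ∧ y ⬝ᵥ p = c ⬝ᵥ xstar p}

section

variable {m d : ℕ} {A : Matrix (Fin m) (Fin d) ℝ} {c : Fin d → ℝ} {H : Set (Fin m → ℝ)}
  {xstar : (Fin m → ℝ) → Fin d → ℝ} {y : Fin m → ℝ}

/-- On the set where a dual solution is optimal, unique primal solutions combine convexly. -/
theorem xstar_convex_comb (hH : Convex ℝ H) (hx : ∀ p ∈ H, LPUniqueOptimal A c p (xstar p))
    (hy : y ᵥ* A ≤ c) {p q : Fin m → ℝ} (hp : p ∈ tightSet c H xstar y)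
    (hq : q ∈ tightSet c H xstar y) {s t : ℝ} (hs : 0 ≤ s) (ht : 0 ≤ t) (hst : s + t = 1) :
    s • p + t • q ∈ tightSet c H xstar y ∧ xstar (s • p + t • q) = s • xstar p + t • xstar q := by
  have hmem := hH hp.1 hq.1 hs ht hst
  have hval : y ⬝ᵥ (s • p + t • q) = c ⬝ᵥ (s • xstar p + t • xstar q) := by
    simp only [dotProduct_add, dotProduct_smul, hp.2, hq.2]
  have heq := (hx _ hmem).2 _
    (((hx p hp.1).1.1.convex_comb (hx q hq.1).1.1 hs ht).optimal_of_tight hy hval)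
  exact ⟨⟨hmem, by rw [hval, heq]⟩, heq.symm⟩

theorem convex_tightSet (hH : Convex ℝ H) (hx : ∀ p ∈ H, LPUniqueOptimal A c p (xstar p))
    (hy : y ᵥ* A ≤ c) : Convex ℝ (tightSet c H xstar y) :=
  fun _ hp _ hq _ _ hs ht hst => (xstar_convex_comb hH hx hy hp hq hs ht hst).1

/-- Complementary slackness: reduced costs vanish on the support of an optimal solution. -/
theorem reducedCost_eq_zero_of_tight {p : Fin m → ℝ} {x : Fin d → ℝ} (hx : LPFeasible A p x)
    (hy : y ᵥ* A ≤ c) (h : y ⬝ᵥ p = c ⬝ᵥ x) {k : Fin d} (hk : x k ≠ 0) : (y ᵥ* A) k = c k := by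
  have hsum : ∑ k, (c k - (y ᵥ* A) k) * x k = 0 := by
    rw [← hx.1, Matrix.dotProduct_mulVec] at h
    simp only [sub_mul, Finset.sum_sub_distrib]
    exact sub_eq_zero.2 h.symm
  have h0 := (Finset.sum_eq_zero_iff_of_nonneg
    fun k _ => mul_nonneg (sub_nonneg.2 (hy k)) (hx.2 k)).1 hsum k (Finset.mem_univ k)
  exact (sub_eq_zero.1 ((mul_eq_zero.1 h0).resolve_right hk)).symm

/-- A kernel vector of `A` supported on the support of a unique optimal solution vanishes. -/
theorem eq_zero_of_supported {p : Fin m → ℝ} {x : Fin d → ℝ} (hx : LPUniqueOptimal A c p x)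
    (hy : y ᵥ* A ≤ c) (h : y ⬝ᵥ p = c ⬝ᵥ x) {w : Fin d → ℝ} (hw : A *ᵥ w = 0)
    (hsupp : ∀ k, x k = 0 → w k = 0) : w = 0 := by
  have hcw : c ⬝ᵥ w = 0 := by
    have : (y ᵥ* A) ⬝ᵥ w = 0 := by rw [← Matrix.dotProduct_mulVec, hw, dotProduct_zero]
    rw [← this]
    refine Finset.sum_congr rfl fun k _ => ?_
    by_cases hk : x k = 0
    · simp [hsupp k hk]
    · rw [reducedCost_eq_zero_of_tight hx.1.1 hy h hk]
  -- Since `w` vanishes off the support of `x`, a small step along it stays feasible; its cost is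
  -- zero, so uniqueness applies.
  have hev : ∀ᶠ ε in nhdsWithin (0 : ℝ) (Set.Ioi 0), ∀ k, 0 ≤ x k + ε * w k := by
    refine Filter.eventually_all.2 fun k => ?_
    by_cases hk : x k = 0
    · simp [hk, hsupp k hk]
    · have hpos : 0 < x k + 0 * w k := by
        simpa using lt_of_le_of_ne (hx.1.1.2 k) (Ne.symm hk)
      have hc : Continuous fun ε : ℝ => x k + ε * w k := by fun_prop
      exact ((hc.tendsto 0).eventually (lt_mem_nhds hpos)).filter_mono nhdsWithin_le_nhds
        |>.mono fun _ h => h.le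
  obtain ⟨ε, hε, hpos⟩ := (hev.and self_mem_nhdsWithin).exists
  have hfeas : LPFeasible A p (x + ε • w) :=
    ⟨by rw [Matrix.mulVec_add, Matrix.mulVec_smul, hw, hx.1.1.1, smul_zero, add_zero], hε⟩
  have heq := hx.2 _ (hfeas.optimal_of_tight hy (by
    rw [dotProduct_add, dotProduct_smul, hcw, smul_zero, add_zero, h]))
  exact (smul_eq_zero.1 (add_eq_left.1 heq)).resolve_left (ne_of_gt hpos)

/-- Where a fixed dual solution is optimal, the unique primal solution depends linearly on the
right-hand side. -/
theorem exists_linearMap_eq_xstar (hH : Convex ℝ H)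
    (hx : ∀ p ∈ H, LPUniqueOptimal A c p (xstar p)) (hy : y ᵥ* A ≤ c) :
    ∃ W : (Fin m → ℝ) →ₗ[ℝ] (Fin d → ℝ), ∀ p ∈ tightSet c H xstar y, W p = xstar p := by
  rcases (tightSet c H xstar y).eq_empty_or_nonempty with hE | hE
  · exact ⟨0, fun p hp => absurd hp (hE ▸ Set.notMem_empty p)⟩
  -- A maximal support contains every other one: the midpoint of `p` and `q` has the union of their
  -- supports.
  obtain ⟨q, hq, hmax⟩ := Set.Finite.exists_maximalFor'
    (fun p => {k | xstar p k ≠ 0}) (tightSet c H xstar y) (Set.toFinite _) hE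
  have hsupp : ∀ p ∈ tightSet c H xstar y, ∀ k, xstar q k = 0 → xstar p k = 0 := by
    intro p hp k hk
    by_contra hpk
    obtain ⟨hmid, hval⟩ := xstar_convex_comb hH hx hy hp hq (s := 1 / 2) (t := 1 / 2)
      (by norm_num) (by norm_num) (by norm_num)
    have hne : ∀ i, 0 ≤ xstar p i ∧ 0 ≤ xstar q i :=
      fun i => ⟨(hx p hp.1).1.1.2 i, (hx q hq.1).1.1.2 i⟩
    refine hmax hmid (fun i (hi : xstar q i ≠ 0) => ?_) (?_ : xstar _ k ≠ 0) hk
    · have := lt_of_le_of_ne (hne i).2 hi.symm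
      have := (hne i).1
      simp only [Set.mem_ofPred_eq, hval, Pi.add_apply, Pi.smul_apply, smul_eq_mul]
      positivity
    · have := lt_of_le_of_ne (hne k).1 (Ne.symm hpk)
      simp only [hval, Pi.add_apply, Pi.smul_apply, smul_eq_mul, hk]
      positivity
  let S : Submodule ℝ (Fin d → ℝ) :=
    { carrier := {w | ∀ k, xstar q k = 0 → w k = 0}
      add_mem' := fun ha hb k hk => by simp [ha k hk, hb k hk]
      zero_mem' := fun _ _ => rfl
      smul_mem' := fun t _ ha k hk => by simp [ha k hk] }
  -- `A` is injective on `S`, so a left inverse recovers `xstar p` from `p`.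
  let f : S →ₗ[ℝ] (Fin m → ℝ) := A.mulVecLin ∘ₗ S.subtype
  have hf : LinearMap.ker f = ⊥ := by
    refine LinearMap.ker_eq_bot'.2 fun w hw => Subtype.ext ?_
    exact eq_zero_of_supported (hx q hq.1) hy hq.2 hw w.2
  obtain ⟨g, hg⟩ := f.exists_leftInverse_of_injective hf
  refine ⟨S.subtype ∘ₗ g, fun p hp => ?_⟩
  have h1 := LinearMap.congr_fun hg ⟨xstar p, hsupp p hp⟩
  have h2 : f ⟨xstar p, hsupp p hp⟩ = p := (hx p hp.1).1.1.1
  rw [LinearMap.comp_apply, h2] at h1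
  rw [LinearMap.comp_apply, h1]
  rfl

end

/-- Used with errors `a` and duality gaps `δ`; `M` bounds the finitely many ratios. -/
theorem exists_nonneg_forall_le_mul {ι : Type*} [Finite ι] (a δ : ι → ℝ) (hδ : ∀ i, 0 ≤ δ i)
    (h : ∀ i, δ i = 0 → a i ≤ 0) : ∃ M, 0 ≤ M ∧ ∀ i, a i ≤ M * δ i := by
  obtain ⟨M, hM⟩ := (Set.finite_range fun i => a i / δ i).bddAbove
  refine ⟨max M 0, le_max_right _ _, fun i => ?_⟩
  rcases (hδ i).eq_or_lt with h0 | h0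
  · rw [← h0, mul_zero]
    exact h i h0.symm
  · exact (div_le_iff₀ h0).1 ((hM ⟨i, rfl⟩).trans (le_max_left _ _))

/-- If the affine piece `l` dominates a finite family of affine pieces on `C`, it is their maximum
on the convex hull of `C`. -/
theorem iSup_affine_eq_of_mem_convexHull {m L : ℕ} (g : Fin L → Fin m → ℝ) (q : Fin L → Fin m → ℝ)
    (e : Fin L → ℝ) {C : Set (Fin m → ℝ)} (l : Fin L)
    (h : ∀ s ∈ C, ∀ l', g l' ⬝ᵥ (s - q l') + e l' ≤ g l ⬝ᵥ (s - q l) + e l)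
    {p : Fin m → ℝ} (hp : p ∈ convexHull ℝ C) :
    ⨆ l', (g l' ⬝ᵥ (p - q l') + e l') = g l ⬝ᵥ (p - q l) + e l := by
  have hle : ∀ l', g l' ⬝ᵥ (p - q l') + e l' ≤ g l ⬝ᵥ (p - q l) + e l := by
    intro l'
    have hlin : IsLinearMap ℝ fun s : Fin m → ℝ => (g l' - g l) ⬝ᵥ s :=
      ⟨fun _ _ => dotProduct_add _ _ _, fun _ _ => dotProduct_smul _ _ _⟩
    have hsub := convexHull_min (s := C)
      (t := {s | (g l' - g l) ⬝ᵥ s ≤ g l' ⬝ᵥ q l' - e l' - g l ⬝ᵥ q l + e l})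
      (fun s hs => by
        have := h s hs l'
        simp only [dotProduct_sub] at this
        simp only [Set.mem_ofPred_eq, sub_dotProduct]
        linarith)
      (convex_halfSpace_le hlin _) hp
    simp only [Set.mem_ofPred_eq, sub_dotProduct] at hsub
    simp only [dotProduct_sub]
    linarith
  have : Nonempty (Fin L) := ⟨l⟩
  exact le_antisymm (ciSup_le hle)
    (le_ciSup (f := fun l' => g l' ⬝ᵥ (p - q l') + e l') (Set.finite_range _).bddAbove l)

theorem theorem1 {m d n L : ℕ} (A : Matrix (Fin m) (Fin d) ℝ) (c : Fin d → ℝ)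
    (b : Fin n → Fin m → ℝ) (xstar : (Fin m → ℝ) → Fin d → ℝ)
    (hxstar : ∀ p ∈ convexHull ℝ (Set.range b), LPUniqueOptimal A c p (xstar p))
    (σ : Fin L → Fin m ↪o Fin d) (cell : Fin n → Fin L)
    (hσ : ∀ j, IsOptimalBasis A c (b j) (σ (cell j))) :
    (∃ (u v : Fin L → Fin d → Fin m → ℝ) (z : Fin n → Fin d → ℝ),
      PolicyInequalities b cell xstar u v z) ∧
    ∀ (u v : Fin L → Fin d → Fin m → ℝ) (z : Fin n → Fin d → ℝ),
      PolicyInequalities b cell xstar u v z →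
      ∀ r : Fin L → Fin n, (∀ l, cell (r l) = l) →
      ∀ l, ∀ p ∈ convexHull ℝ (cellSet b cell l),
        pldcPolicy b xstar r u v z p = xstar p := by
  set H := convexHull ℝ (Set.range b) with hHdef
  have hH : Convex ℝ H := convex_convexHull ℝ _
  have hb : ∀ j, b j ∈ H := fun j => subset_convexHull ℝ _ ⟨j, rfl⟩
  set y : Fin L → Fin m → ℝ := fun l => basisDual A c (σ l) with hydef
  have hy : ∀ j, y (cell j) ᵥ* A ≤ c := fun j => (hσ j).dual_feasible
  have htight : ∀ j, b j ∈ tightSet c H xstar (y (cell j)) :=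
    fun j => ⟨hb j, (hxstar _ (hb j)).tight_of_isOptimalBasis (hσ j)⟩
  have hweak : ∀ i j, y (cell j) ⬝ᵥ b i ≤ c ⬝ᵥ xstar (b i) :=
    fun i j => (hxstar _ (hb i)).1.1.weak_duality (hy j)
  -- `𝐁⁻¹` cannot replace `W`: a zero duality gap does not make the basis primal feasible. Unused
  -- labels get the map 0.
  have hWex : ∀ l, ∃ W : (Fin m → ℝ) →ₗ[ℝ] (Fin d → ℝ),
      (∃ j, cell j = l) → ∀ p ∈ tightSet c H xstar (y l), W p = xstar p := by
    intro l
    by_cases hl : ∃ j, cell j = l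
    · obtain ⟨j, rfl⟩ := hl
      obtain ⟨W, hW⟩ := exists_linearMap_eq_xstar hH hxstar (hy j)
      exact ⟨W, fun _ => hW⟩
    · exact ⟨0, fun h => absurd h hl⟩
  choose W hW using hWex
  constructor
  · obtain ⟨M, hM0, hM⟩ := exists_nonneg_forall_le_mul
      (fun t : Fin n × Fin n × Fin d => W (cell t.2.1) (b t.1) t.2.2 - xstar (b t.1) t.2.2)
      (fun t => c ⬝ᵥ xstar (b t.1) - y (cell t.2.1) ⬝ᵥ b t.1)
      (fun t => sub_nonneg.2 (hweak _ _))
      (fun t ht => by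
        rw [hW _ ⟨_, rfl⟩ _ ⟨hb _, (sub_eq_zero.1 ht).symm⟩, sub_self])
    -- `z` is `M` times the optimal value and `v` its subgradient; `u` adds row `k` of `W l`.
    refine ⟨fun l k => (LinearMap.toMatrix' (W l)) k + M • y l, fun l _ => M • y l,
      fun j _ => M * (c ⬝ᵥ xstar (b j)), fun k i j => ?_, fun k i j => ?_⟩
    · have hrow : ∀ p, LinearMap.toMatrix' (W (cell j)) k ⬝ᵥ p = W (cell j) p k :=
        fun p => congrFun (LinearMap.toMatrix'_mulVec (W (cell j)) p) k
      have h1 := hM (i, j, k)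
      have h2 := congrFun (hW _ ⟨j, rfl⟩ _ (htight j)) k
      have h3 := (htight j).2
      simp only [add_dotProduct, dotProduct_sub, smul_dotProduct, smul_eq_mul, hrow, h2, h3]
      simp only at h1
      linarith
    · have h1 := mul_le_mul_of_nonneg_left (hweak i j) hM0
      simp only [dotProduct_sub, smul_dotProduct, smul_eq_mul, (htight j).2]
      linarith
  · rintro u v z ⟨hu, hv⟩ r hr l p hp
    have hu' : ∀ k i l', u l' k ⬝ᵥ (b i - b (r l')) + (xstar (b (r l')) k + z (r l') k) ≤
        xstar (b i) k + z i k := fun k i l' => by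
      have := hu k i (r l')
      rw [hr] at this
      linarith
    have hv' : ∀ k i l', v l' k ⬝ᵥ (b i - b (r l')) + z (r l') k ≤ z i k := fun k i l' => by
      have := hv k i (r l')
      rwa [hr] at this
    -- Exchanging `j` and `r l` gives the reverse inequality with the same slope.
    have hueq : ∀ k j, cell j = l → u l k ⬝ᵥ (b j - b (r l)) +
        (xstar (b (r l)) k + z (r l) k) = xstar (b j) k + z j k := fun k j hj => by
      have h1 := hu k (r l) j
      have h2 := hu' k j l
      rw [hj] at h1
      simp only [dotProduct_sub] at h1 h2 ⊢
      linarith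
    have hveq : ∀ k j, cell j = l → v l k ⬝ᵥ (b j - b (r l)) + z (r l) k = z j k :=
      fun k j hj => by
        have h1 := hv k (r l) j
        have h2 := hv' k j l
        rw [hj] at h1
        simp only [dotProduct_sub] at h1 h2 ⊢
        linarith
    have hsub : convexHull ℝ (cellSet b cell l) ⊆ tightSet c H xstar (y l) :=
      convexHull_min (by rintro _ ⟨j, rfl, rfl⟩; exact htight j)
        (by have := hy (r l); rw [hr] at this; exact convex_tightSet hH hxstar this)
    have hWl := hW l ⟨r l, hr l⟩
    ext k
    have hU := iSup_affine_eq_of_mem_convexHull (fun l' => u l' k) (fun l' => b (r l'))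
      (fun l' => xstar (b (r l')) k + z (r l') k) l
      (by rintro _ ⟨j, hj, rfl⟩ l'; exact (hu' k j l').trans_eq (hueq k j hj).symm) hp
    have hV := iSup_affine_eq_of_mem_convexHull (fun l' => v l' k) (fun l' => b (r l'))
      (fun l' => z (r l') k) l
      (by rintro _ ⟨j, hj, rfl⟩ l'; exact (hv' k j l').trans_eq (hveq k j hj).symm) hp
    simp only [← add_assoc] at hU
    rw [pldcPolicy, hU, hV, ← hWl p (hsub hp)]
    have hlin : IsLinearMap ℝ fun s : Fin m → ℝ => (u l k - v l k) ⬝ᵥ s - W l s k :=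
      ⟨fun s t => by simp only [dotProduct_add, map_add, Pi.add_apply]; ring,
        fun a s => by simp only [dotProduct_smul, map_smul, Pi.smul_apply, smul_eq_mul]; ring⟩
    have hmem := convexHull_min (s := cellSet b cell l)
      (t := {s | (u l k - v l k) ⬝ᵥ s - W l s k =
        (u l k - v l k) ⬝ᵥ b (r l) - xstar (b (r l)) k})
      (by
        rintro _ ⟨j, hj, rfl⟩
        have h1 := hueq k j hj
        have h2 := hveq k j hj
        have h3 := congrFun (hWl _ (hsub (subset_convexHull ℝ _ ⟨j, hj, rfl⟩))) k
        simp only [dotProduct_sub] at h1 h2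
        simp only [Set.mem_ofPred_eq, sub_dotProduct, h3]
        linarith)
      (convex_hyperplane hlin _) hp
    simp only [Set.mem_ofPred_eq, sub_dotProduct] at hmem
    simp only [dotProduct_sub]
    linarith
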